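/- Let $n\ge 1$, $s\in(0,1)$, and let $\Omega\subset\mathbb R^n$ be a bounded domain with smooth boundary; write $A^c=\mathbb R^n\setminus A$. For a set $A$ let $|v|_{H^s(A)}^2=\iint_{A\times A}\frac{|v(x)-v(y)|^2}{|x-y|^{n+2s}}\,dx\,dy$, $H^s(A)=\{v\in L^2(A):|v|_{H^s(A)}<\infty\}$, $\|v\|_{H^s(A)}^2=\|v\|_{L^2(A)}^2+|v|_{H^s(A)}^2$, let $\widetilde H^s(\Omega)=\{v\in H^s(\mathbb R^n):\operatorname{supp}v\subset\overline\Omega\}$, and let $H^{-s}(\Omega)$ be the dual of $\widetilde H^s(\Omega)$ (with the $H^s(\mathbb R^n)$ norm). For $f\in H^{-s}(\Omega)$ and $g\in H^s(\Omega^c)$, the solution $u$ of $$(-\Delta)^su=f\ \text{ in }\Omega,\qquad u=g\ \text{ in }\Omega^c$$ is the function $u\in H^s(\mathbb R^n)$ with $u=g$ a.e. in $\Omega^c$ and $$\frac{C(n,s)}2\iint_{(\Omega\times\mathbb R^n)\cup(\mathbb R^n\times\Omega)}\frac{(u(x)-u(y))(v(x)-v(y))}{|x-y|^{n+2s}}\,dx\,dy=\langle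 f,v\rangle\qquad\forall v\in\widetilde H^s(\Omega),$$ where $C(n,s)=\frac{2^{2s}s\,\Gamma(s+n/2)}{\pi^{n/2}\Gamma(1-s)}$. Let $c,C_0>0$. There is a constant $C>0$, depending only on $n,s,\Omega,c,C_0$, such that the following holds. Let $H_0\ge1$ and let $(\Omega_H)_{H>H_0}$ be a family of bounded domains containing $\Omega$ with $$cH\le\min_{x\in\partial\Omega,\,y\in\partial\Omega_H}|x-y|\le\max_{x\in\partial\Omega,\,y\in\partial\Omega_H}|x-y|\le C_0H\qquad\text{for all }H>H_0.$$ Let $H-1>H_0$ and let $\eta\in C^\infty(\Omega^c)$ satisfy $0\le\eta\le1$, $\operatorname{supp}\eta\subset\overline{\Omega_H}\setminus\Omega$ and $\eta=1$ in $\Omega_{H-1}\setminus\Omega$. Let $f\in H^{-s}(\Omega)$ and $g\in H^s(\Omega^c)$, let $u$ be the solution with data $f,g$, and let $\tilde u$ be the solution with data $f$ and truncated datum $\eta g$. Then $$|u-\tilde u|_{H^s(\Omega)}\le C\,H^{-(n/2+2s)}\,\|g\|_{L^2(\Omega_{H-1}^c)}.$$ In particular, $C$ is independent of $H$, $g$,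 $f$, $\eta$ and the family $(\Omega_H)$. -/

import Mathlib

open MeasureTheory Set
open scoped ENNReal NNReal ContDiff

noncomputable section

namespace FracDirichlet

variable {n : ℕ}

/-- A bounded smooth domain of `ℝⁿ`: a nonempty, connected, bounded open set which near each of its
boundary points is the sublevel set `{ρ < 0}` of a `C^∞` function with nonvanishing differential. -/
structure IsBoundedSmoothDomain (Ω : Set (EuclideanSpace ℝ (Fin n))) : Prop where
  isOpen : IsOpen Ω
  isConnected : IsConnected Ω
  isBounded : Bornology.IsBounded Ω
  smooth_boundary : ∀ x₀ ∈ frontier Ω,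
    ∃ (U : Set (EuclideanSpace ℝ (Fin n))) (ρ : EuclideanSpace ℝ (Fin n) → ℝ),
      IsOpen U ∧ x₀ ∈ U ∧ ContDiffOn ℝ ∞ ρ U ∧ (∀ x ∈ U, fderiv ℝ ρ x ≠ 0) ∧
      Ω ∩ U = {x ∈ U | ρ x < 0}

/-- The square of the Aronszajn–Slobodeckij seminorm,
`∬_{A × A} |v(x) - v(y)|² / |x - y|^{n + 2s} dx dy`, with values in `[0, ∞]`. -/
def seminormSq (s : ℝ) (A : Set (EuclideanSpace ℝ (Fin n)))
    (v : EuclideanSpace ℝ (Fin n) → ℝ) : ℝ≥0∞ :=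
  ∫⁻ x in A, ∫⁻ y in A, ENNReal.ofReal (|v x - v y| ^ 2 / ‖x - y‖ ^ ((n : ℝ) + 2 * s))

/-- The Aronszajn–Slobodeckij seminorm `|v|_{H^s(A)}`. -/
def hsSeminorm (s : ℝ) (A : Set (EuclideanSpace ℝ (Fin n)))
    (v : EuclideanSpace ℝ (Fin n) → ℝ) : ℝ≥0∞ :=
  seminormSq s A v ^ (1 / 2 : ℝ)

/-- The norm `‖v‖_{H^s(A)}`. -/
def hsNorm (s : ℝ) (A : Set (EuclideanSpace ℝ (Fin n)))
    (v : EuclideanSpace ℝ (Fin n) → ℝ) : ℝ≥0∞ :=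
  (eLpNorm v 2 (volume.restrict A) ^ 2 + seminormSq s A v) ^ (1 / 2 : ℝ)

/-- `v` (restricted to `A`) belongs to `H^s(A)`. -/
def MemHs (s : ℝ) (A : Set (EuclideanSpace ℝ (Fin n)))
    (v : EuclideanSpace ℝ (Fin n) → ℝ) : Prop :=
  MemLp v 2 (volume.restrict A) ∧ hsSeminorm s A v < ⊤

/-- `v` belongs to `H̃^s(Ω)`: it is in `H^s(ℝⁿ)` and its (essential) support lies in the closure
of `Ω`. -/
def MemHsTilde (s : ℝ) (Ω : Set (EuclideanSpace ℝ (Fin n)))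
    (v : EuclideanSpace ℝ (Fin n) → ℝ) : Prop :=
  MemHs s univ v ∧ ∀ᵐ x ∂(volume : Measure (EuclideanSpace ℝ (Fin n))), x ∉ closure Ω → v x = 0

/-- `F` is an element of `H^{-s}(Ω)`, the dual space of `H̃^s(Ω)`: a linear functional on `H̃^s(Ω)`
which is bounded for the norm of `H^s(ℝⁿ)`. -/
structure IsHsDual (s : ℝ) (Ω : Set (EuclideanSpace ℝ (Fin n)))
    (F : (EuclideanSpace ℝ (Fin n) → ℝ) → ℝ) : Prop where
  map_add : ∀ v w, MemHsTilde s Ω v → MemHsTilde s Ω w → F (v + w) = F v + F w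
  map_smul : ∀ (t : ℝ) (v), MemHsTilde s Ω v → F (t • v) = t * F v
  bounded : ∃ M : ℝ≥0, ∀ v, MemHsTilde s Ω v → ENNReal.ofReal |F v| ≤ M * hsNorm s univ v

/-- The normalization constant `C(n,s)` of the fractional Laplacian. -/
def fracConst (n : ℕ) (s : ℝ) : ℝ :=
  2 ^ (2 * s) * s * Real.Gamma (s + n / 2) / (Real.pi ^ ((n : ℝ) / 2) * Real.Gamma (1 - s))

/-- The bilinear form `a(u,v) = (C(n,s)/2) ∬_Q (u(x)-u(y)) (v(x)-v(y)) / |x-y|^{n+2s} dx dy`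
of the fractional Laplacian, where `Q = (Ω × ℝⁿ) ∪ (ℝⁿ × Ω)`. -/
def form (s : ℝ) (Ω : Set (EuclideanSpace ℝ (Fin n)))
    (u v : EuclideanSpace ℝ (Fin n) → ℝ) : ℝ :=
  fracConst n s / 2 *
    ∫ p in (Ω ×ˢ univ) ∪ (univ ×ˢ Ω),
      (u p.1 - u p.2) * (v p.1 - v p.2) / ‖p.1 - p.2‖ ^ ((n : ℝ) + 2 * s)
      ∂((volume : Measure (EuclideanSpace ℝ (Fin n))).prod volume)

/-- `u` is the (weak) solution of `(-Δ)^s u = f` in `Ω`, `u = g` in `Ωᶜ`; the right-hand side is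
given as the functional `F(v) = ∫_Ω f v`. -/
structure IsSolution (s : ℝ) (Ω : Set (EuclideanSpace ℝ (Fin n)))
    (F : (EuclideanSpace ℝ (Fin n) → ℝ) → ℝ) (g u : EuclideanSpace ℝ (Fin n) → ℝ) : Prop where
  memHs : MemHs s univ u
  eq_datum : ∀ᵐ x ∂(volume.restrict Ωᶜ), u x = g x
  weak_eq : ∀ v, MemHsTilde s Ω v → form s Ω u v = F v

/-- A family of bounded domains `Ω_H ⊇ Ω`, `H > H₀`, such that the distance between any point of
`∂Ω` and any point of `∂Ω_H` lies between `c H` and `C H`. -/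
structure IsTruncationFamily (Ω : Set (EuclideanSpace ℝ (Fin n))) (c C H₀ : ℝ)
    (D : ℝ → Set (EuclideanSpace ℝ (Fin n))) : Prop where
  isOpen : ∀ H, H₀ < H → IsOpen (D H)
  isConnected : ∀ H, H₀ < H → IsConnected (D H)
  isBounded : ∀ H, H₀ < H → Bornology.IsBounded (D H)
  subset : ∀ H, H₀ < H → Ω ⊆ D H
  dist_bounds : ∀ H, H₀ < H → ∀ x ∈ frontier Ω, ∀ y ∈ frontier (D H),
    c * H ≤ dist x y ∧ dist x y ≤ C * H

/-- `η ∈ C^∞(Ωᶜ)` with `0 ≤ η ≤ 1`, `supp η ⊆ closure A \ Ω` and `η = 1` in `B \ Ω`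
(to be used with `A = Ω_H` and `B = Ω_{H-1}`). Only the values of `η` on `Ωᶜ` matter. -/
structure IsCutoff (Ω A B : Set (EuclideanSpace ℝ (Fin n)))
    (η : EuclideanSpace ℝ (Fin n) → ℝ) : Prop where
  smooth : ContDiffOn ℝ ∞ η Ωᶜ
  nonneg : ∀ x ∈ Ωᶜ, 0 ≤ η x
  le_one : ∀ x ∈ Ωᶜ, η x ≤ 1
  support_subset : closure {x | x ∈ Ωᶜ ∧ η x ≠ 0} ⊆ closure A \ Ω
  eq_one : ∀ x ∈ B \ Ω, η x = 1

end FracDirichlet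

end

open MeasureTheory Set
open scoped ENNReal NNReal ContDiff

namespace FracDirichlet

/-! The difference w = u - ũ satisfies the homogeneous weak equation in Ω, vanishes on D \ Ω for D =
Ω_{H-1}, and equals (1 - η) g outside Ω. Every point of Ω is at distance at least R = cH/2 from Dᶜ.

Because of this gap, 1_Ω w is an admissible test function (`MemHs.indicator_memHsTilde`). Testing
with it gives (`energy_le`) |w|²_{H^s(Ω)} + 2∬_{Ω×Ωᶜ} w(x)²/|x-y|^{n+2s} ≤ 2∬_{Ω×Dᶜ}
|w(x)||w(y)|/|x-y|^{n+2s}.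

The second term on the left dominates 2ρ‖w‖²_{L²(Ω)}, with ρ depending only on n, s, Ω; it plays the
role of a Poincaré inequality. Young's inequality bounds the right side by θT‖w‖²_{L²(Ω)} +
θ⁻¹|Ω|‖w‖²_{L²(Dᶜ)}, where T ~ R^{-(n+4s)} is the tail of the squared kernel. Taking θ = 2ρ/T
cancels the L²(Ω) terms exactly, and a square root gives the rate H^{-(n/2+2s)}. -/

/-! ### Kernel bounds and geometry of the gap. -/

theorem lintegral_norm_rpow_tail {n : ℕ} {β : ℝ} (hβ : (n : ℝ) < β) :
    ∃ M : ℝ, 0 < M ∧ ∀ R : ℝ, 0 < R →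
      ∫⁻ z : EuclideanSpace ℝ (Fin n),
        indicator {z | R ≤ ‖z‖} (fun z => ENNReal.ofReal ((‖z‖ ^ β)⁻¹)) z
        ≤ ENNReal.ofReal (M * R ^ ((n : ℝ) - β)) := by
  have hβ0 : 0 < β := lt_of_le_of_lt n.cast_nonneg hβ
  set f : EuclideanSpace ℝ (Fin n) → ℝ := fun x => (1 + ‖x‖) ^ (-β) with hf
  have hfi : Integrable f volume := integrable_one_add_norm (by simpa using hβ)
  have hf0 : ∀ x, 0 ≤ f x := fun x => by positivity
  have hI : 0 ≤ ∫ x, f x := integral_nonneg hf0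
  -- On |z| ≥ R one has R + |z| ≤ 2|z|, so the kernel is at most 2^β times a rescaling of (1 +
  -- |x|)^{-β}; the + 1 makes positivity of M immediate.
  refine ⟨2 ^ β * ((∫ x, f x) + 1), by positivity, fun R hR => ?_⟩
  have hcomp : Integrable (fun x => 2 ^ β * R ^ (-β) * f (R⁻¹ • x)) volume :=
    (hfi.comp_smul (inv_ne_zero hR.ne')).const_mul _
  calc _ ≤ ∫⁻ z, ENNReal.ofReal (2 ^ β * R ^ (-β) * f (R⁻¹ • z)) := by
        refine lintegral_mono (indicator_le' (fun z hz => ?_) fun _ _ => bot_le)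
        refine ENNReal.ofReal_le_ofReal ?_
        have hz' : R ≤ ‖z‖ := hz
        have hzp : 0 < ‖z‖ := hR.trans_le hz'
        have h1 : 1 + ‖R⁻¹ • z‖ = R⁻¹ * (R + ‖z‖) := by
          rw [norm_smul, Real.norm_of_nonneg (by positivity)]; field_simp
        rw [hf]; simp only
        rw [h1, ← Real.rpow_neg hzp.le, Real.mul_rpow (by positivity) (by positivity),
          Real.inv_rpow hR.le, ← Real.rpow_neg hR.le, neg_neg]
        have h2 : (2 * ‖z‖) ^ (-β) ≤ (R + ‖z‖) ^ (-β) :=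
          Real.rpow_le_rpow_of_nonpos (by positivity) (by linarith) (by linarith)
        rw [Real.mul_rpow (by norm_num) hzp.le] at h2
        have h3 : (2 : ℝ) ^ β * 2 ^ (-β) = 1 := by
          rw [← Real.rpow_add (by norm_num)]; simp
        have h4 : R ^ (-β) * R ^ β = 1 := by
          rw [← Real.rpow_add hR]; simp
        calc ‖z‖ ^ (-β) = 2 ^ β * (2 ^ (-β) * ‖z‖ ^ (-β)) := by rw [← mul_assoc, h3, one_mul]
          _ ≤ 2 ^ β * (R + ‖z‖) ^ (-β) := by gcongr
          _ = 2 ^ β * (R ^ (-β) * R ^ β) * (R + ‖z‖) ^ (-β) := by rw [h4, mul_one]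
          _ = _ := by ring
    _ = ENNReal.ofReal (2 ^ β * R ^ (-β) * (R ^ n * ∫ x, f x)) := by
        rw [← ofReal_integral_eq_lintegral_ofReal hcomp
          (ae_of_all _ fun x => by have := hf0 (R⁻¹ • x); positivity),
          integral_const_mul, Measure.integral_comp_inv_smul_of_nonneg _ _ hR.le]
        simp
    _ ≤ _ := by
        refine ENNReal.ofReal_le_ofReal ?_
        rw [sub_eq_neg_add, Real.rpow_add hR, Real.rpow_natCast]
        have : 0 ≤ 2 ^ β * (R ^ (-β) * R ^ n) := by positivity
        nlinarith

/-- A fixed ball disjoint from Ω lies within bounded distance of every point of Ω and already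
contributes a uniform amount. -/
theorem exists_lintegral_compl_kernel_ge {n : ℕ} (hn : 1 ≤ n)
    {Ω : Set (EuclideanSpace ℝ (Fin n))} (hΩ : Bornology.IsBounded Ω) {α : ℝ} (hα : 0 ≤ α) :
    ∃ ρ : ℝ, 0 < ρ ∧ ∀ x ∈ Ω,
      ENNReal.ofReal ρ ≤ ∫⁻ y in Ωᶜ, ENNReal.ofReal ((‖x - y‖ ^ α)⁻¹) := by
  obtain ⟨d, hd, hsub⟩ := hΩ.subset_ball_lt 0 0
  have : Nonempty (Fin n) := ⟨⟨0, hn⟩⟩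
  obtain ⟨p, hp⟩ := NormedSpace.exists_lt_norm ℝ (EuclideanSpace ℝ (Fin n)) (2 * d)
  have hV0 : 0 < volume (Metric.ball p d) := Metric.measure_ball_pos _ _ hd
  have hVt : volume (Metric.ball p d) ≠ ⊤ := measure_ball_lt_top.ne
  have hV : 0 < (volume (Metric.ball p d)).toReal := ENNReal.toReal_pos hV0.ne' hVt
  have hr : 0 < 2 * d + ‖p‖ := by positivity
  refine ⟨((2 * d + ‖p‖) ^ α)⁻¹ * (volume (Metric.ball p d)).toReal, by positivity, fun x hx => ?_⟩
  have hx' : ‖x‖ < d := by simpa using hsub hx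
  have hball : Metric.ball p d ⊆ Ωᶜ := by
    intro y hy hyΩ
    have h1 : ‖y‖ < d := by simpa using hsub hyΩ
    have h2 : ‖y - p‖ < d := by simpa [dist_eq_norm] using hy
    have h3 : ‖p‖ ≤ ‖y‖ + ‖y - p‖ := by
      have := norm_sub_le y (y - p); simpa using this
    linarith
  calc _ = ∫⁻ y in Metric.ball p d, ENNReal.ofReal (((2 * d + ‖p‖) ^ α)⁻¹) := by
        rw [setLIntegral_const, ENNReal.ofReal_mul (by positivity), ENNReal.ofReal_toReal hVt]
    _ ≤ ∫⁻ y in Metric.ball p d, ENNReal.ofReal ((‖x - y‖ ^ α)⁻¹) := by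
        refine setLIntegral_mono' measurableSet_ball fun y hy => ENNReal.ofReal_le_ofReal ?_
        have h2 : ‖y - p‖ < d := by simpa [dist_eq_norm] using hy
        have hne : 0 < ‖x - y‖ := by
          rw [norm_sub_pos_iff]; rintro rfl; exact hball hy hx
        have h3 : ‖x - y‖ ≤ 2 * d + ‖p‖ := by
          have e1 := norm_sub_le x y
          have e2 := norm_add_le (y - p) p
          simp only [sub_add_cancel] at e2
          linarith
        gcongr
    _ ≤ _ := lintegral_mono_set hball

/-- A segment from `Ω` to the complement of `D ⊇ Ω` meets the two boundaries in turn. -/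
theorem le_dist_of_le_dist_frontier {E : Type*} [NormedAddCommGroup E] [NormedSpace ℝ E]
    {Ω D : Set E} (hΩ : IsOpen Ω) (hD : IsOpen D) (hsub : Ω ⊆ D) {R : ℝ}
    (hR : ∀ x ∈ frontier Ω, ∀ y ∈ frontier D, R ≤ dist x y)
    {x y : E} (hx : x ∈ Ω) (hy : y ∉ D) : R ≤ dist x y := by
  have exit : ∀ A : Set E, IsOpen A → x ∈ A → y ∉ A → ∃ t ∈ Icc (0 : ℝ) 1,
      AffineMap.lineMap x y t ∈ frontier A ∧
        ∀ r ∈ Icc (0 : ℝ) 1, AffineMap.lineMap x y r ∉ A → t ≤ r := by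
    intro A hA hxA hyA
    have hcont : Continuous (AffineMap.lineMap x y : ℝ → E) := AffineMap.lineMap_continuous
    have hK : IsCompact (Icc (0 : ℝ) 1 ∩ (AffineMap.lineMap x y : ℝ → E) ⁻¹' Aᶜ) :=
      isCompact_Icc.inter_right (hA.isClosed_compl.preimage hcont)
    -- The first exit time from A: the segment stays in A before t, so its point at t lies on the
    -- frontier.
    obtain ⟨t, ⟨ht, htA⟩, hmin⟩ := hK.exists_isLeast ⟨1, by simp [hyA]⟩
    refine ⟨t, ht, ⟨?_, by rwa [hA.interior_eq]⟩, fun r hr hrA => hmin ⟨hr, hrA⟩⟩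
    have ht0 : 0 < t := by
      refine lt_of_le_of_ne ht.1 ?_
      rintro rfl
      simp [hxA] at htA
    have hlt : ∀ r ∈ Ico 0 t, AffineMap.lineMap x y r ∈ A := fun r hr => by
      by_contra h
      exact absurd (hmin ⟨⟨hr.1, hr.2.le.trans ht.2⟩, h⟩) (not_le.2 hr.2)
    have hcl : t ∈ closure (Ico 0 t) := by
      rw [closure_Ico ht0.ne]; exact ⟨ht0.le, le_rfl⟩
    exact map_mem_closure hcont hcl hlt
  obtain ⟨t₁, ht₁, hf₁, hmin₁⟩ := exit Ω hΩ hx fun h => hy (hsub h)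
  obtain ⟨t₂, ht₂, hf₂, -⟩ := exit D hD (hsub hx) hy
  -- The exit point from D lies outside D, hence outside Ω, so the segment has left Ω by then.
  have h12 : t₁ ≤ t₂ := hmin₁ t₂ ht₂ fun h => by
    rw [frontier, hD.interior_eq] at hf₂
    exact hf₂.2 (hsub h)
  refine (hR _ hf₁ _ hf₂).trans ?_
  rw [dist_lineMap_lineMap, Real.dist_eq, abs_sub_comm, abs_of_nonneg (by linarith)]
  exact mul_le_of_le_one_left dist_nonneg (by linarith [ht₁.1, ht₂.2])

/-! ### Double integrals and the space H^s. -/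

theorem lintegral_prod_mul_sub {G : Type*} [AddGroup G] [MeasurableSpace G] [MeasurableAdd₂ G]
    [MeasurableNeg G] {μ ν : Measure G} [SFinite μ] [SFinite ν] [ν.IsAddLeftInvariant]
    [ν.IsNegInvariant] {f h : G → ℝ≥0∞} (hf : AEMeasurable f μ) (hh : Measurable h) :
    ∫⁻ p, f p.1 * h (p.1 - p.2) ∂(μ.prod ν) = (∫⁻ x, f x ∂μ) * ∫⁻ z, h z ∂ν := by
  have hm : AEMeasurable (fun p : G × G => f p.1 * h (p.1 - p.2)) (μ.prod ν) := by
    refine hf.comp_fst.mul (hh.comp (by fun_prop)).aemeasurable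
  rw [lintegral_prod _ hm]
  have : ∀ x, ∫⁻ y, f x * h (x - y) ∂ν = f x * ∫⁻ z, h z ∂ν := fun x => by
    rw [lintegral_const_mul _ (by fun_prop), lintegral_sub_left_eq_self h x]
  simp_rw [this]
  rw [lintegral_mul_const'' _ hf]

theorem seminormSq_eq_setLIntegral_prod {n : ℕ} (s : ℝ) (A : Set (EuclideanSpace ℝ (Fin n)))
    {w : EuclideanSpace ℝ (Fin n) → ℝ} (hw : AEMeasurable w volume) :
    seminormSq s A w = ∫⁻ p in A ×ˢ A,
      ENNReal.ofReal ((w p.1 - w p.2) ^ 2 / ‖p.1 - p.2‖ ^ ((n : ℝ) + 2 * s))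
        ∂(volume.prod volume) := by
  rw [setLIntegral_prod]
  · simp only [seminormSq, sq_abs]
  · exact AEMeasurable.restrict (by fun_prop)

theorem MemHs.aemeasurable {n : ℕ} {s : ℝ} {w : EuclideanSpace ℝ (Fin n) → ℝ}
    (hw : MemHs s univ w) : AEMeasurable w volume := by
  simpa using hw.1.aestronglyMeasurable.aemeasurable

theorem MemHs.integrable_sq_sub_div {n : ℕ} {s : ℝ} {w : EuclideanSpace ℝ (Fin n) → ℝ}
    (hw : MemHs s univ w) :
    Integrable (fun p : EuclideanSpace ℝ (Fin n) × EuclideanSpace ℝ (Fin n) =>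
      (w p.1 - w p.2) ^ 2 / ‖p.1 - p.2‖ ^ ((n : ℝ) + 2 * s)) (volume.prod volume) := by
  have hm := hw.aemeasurable
  refine ⟨AEMeasurable.aestronglyMeasurable (by fun_prop), ?_⟩
  rw [hasFiniteIntegral_iff_ofReal (ae_of_all _ fun p => by positivity)]
  have h := seminormSq_eq_setLIntegral_prod s univ hm
  rw [univ_prod_univ, setLIntegral_univ] at h
  rw [← h]
  by_contra hc
  have h2 := hw.2
  rw [hsSeminorm, not_lt_top_iff.1 hc] at h2
  simp at h2

theorem MemHs.integrable_mul_div {n : ℕ} {s : ℝ} {w v : EuclideanSpace ℝ (Fin n) → ℝ}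
    (hw : MemHs s univ w) (hv : MemHs s univ v) :
    Integrable (fun p : EuclideanSpace ℝ (Fin n) × EuclideanSpace ℝ (Fin n) =>
      (w p.1 - w p.2) * (v p.1 - v p.2) / ‖p.1 - p.2‖ ^ ((n : ℝ) + 2 * s))
      (volume.prod volume) := by
  have hwm := hw.aemeasurable
  have hvm := hv.aemeasurable
  refine (hw.integrable_sq_sub_div.add hv.integrable_sq_sub_div).mono'
    (AEMeasurable.aestronglyMeasurable (by fun_prop)) (ae_of_all _ fun p => ?_)
  have hk : 0 ≤ ‖p.1 - p.2‖ ^ ((n : ℝ) + 2 * s) := by positivity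
  rw [Pi.add_apply, ← add_div, Real.norm_eq_abs, abs_div, abs_of_nonneg hk]
  refine div_le_div_of_nonneg_right ?_ hk
  rw [abs_le]
  constructor <;> nlinarith [sq_nonneg (w p.1 - w p.2 + (v p.1 - v p.2)),
    sq_nonneg (w p.1 - w p.2 - (v p.1 - v p.2)), sq_nonneg (w p.1 - w p.2),
    sq_nonneg (v p.1 - v p.2)]

theorem form_sub {n : ℕ} {s : ℝ} {Ω : Set (EuclideanSpace ℝ (Fin n))}
    {u u' v : EuclideanSpace ℝ (Fin n) → ℝ}
    (hu : MemHs s univ u) (hu' : MemHs s univ u') (hv : MemHs s univ v) :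
    form s Ω (u - u') v = form s Ω u v - form s Ω u' v := by
  rw [form, form, form, ← mul_sub, ← integral_sub (hu.integrable_mul_div hv).integrableOn
    (hu'.integrable_mul_div hv).integrableOn]
  congr 2
  ext p
  simp only [Pi.sub_apply]
  ring

theorem MemHs.sub {n : ℕ} {s : ℝ} {u u' : EuclideanSpace ℝ (Fin n) → ℝ}
    (hu : MemHs s univ u) (hu' : MemHs s univ u') : MemHs s univ (u - u') := by
  have hum := hu.aemeasurable
  have hum' := hu'.aemeasurable
  refine ⟨hu.1.sub hu'.1, ?_⟩
  have hi := (hu.integrable_sq_sub_div.add hu'.integrable_sq_sub_div).const_mul 2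
  rw [hsSeminorm, seminormSq_eq_setLIntegral_prod s univ (hum.sub hum'), univ_prod_univ,
    setLIntegral_univ]
  refine ENNReal.rpow_lt_top_of_nonneg (by norm_num) (ne_of_lt (lt_of_le_of_lt
    (lintegral_mono fun p => ENNReal.ofReal_le_ofReal ?_) hi.lintegral_lt_top))
  simp only [Pi.add_apply, Pi.sub_apply]
  rw [← add_div, ← mul_div_assoc]
  refine div_le_div_of_nonneg_right ?_ (by positivity)
  nlinarith [sq_nonneg (u p.1 - u p.2 + (u' p.1 - u' p.2))]

/-! ### Energy estimate in Ω. -/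

/-- Restricting to `Ω` a function of `H^s` which vanishes near `Ω` outside it does not leave `H^s`. -/
theorem MemHs.indicator_memHsTilde {n : ℕ} {s : ℝ} (hs : 0 < s)
    {Ω D : Set (EuclideanSpace ℝ (Fin n))} (hΩ : MeasurableSet Ω) {R : ℝ} (hR : 0 < R)
    (hdist : ∀ x ∈ Ω, ∀ y ∉ D, R ≤ dist x y)
    {w : EuclideanSpace ℝ (Fin n) → ℝ} (hw : MemHs s univ w)
    (h0 : ∀ᵐ x, x ∈ D \ Ω → w x = 0) : MemHsTilde s Ω (indicator Ω w) := by
  have hwm := hw.aemeasurable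
  refine ⟨⟨hw.1.indicator hΩ, ?_⟩, ae_of_all _ fun x hx =>
    indicator_of_notMem (fun h => hx (subset_closure h)) w⟩
  obtain ⟨M, -, hM⟩ := lintegral_norm_rpow_tail (n := n) (β := (n : ℝ) + 2 * s) (by linarith)
  set h : EuclideanSpace ℝ (Fin n) → ℝ≥0∞ := indicator {z | R ≤ ‖z‖}
    (fun z => ENNReal.ofReal ((‖z‖ ^ ((n : ℝ) + 2 * s))⁻¹)) with hh
  have hmeas : Measurable h :=
    Measurable.indicator (by fun_prop) (measurableSet_le measurable_const measurable_norm)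
  -- `T` pays for pairs in Ω × Dᶜ, where cutting off w(y) may increase the difference; it is
  -- integrable because the kernel is integrable away from 0.
  set T : EuclideanSpace ℝ (Fin n) × EuclideanSpace ℝ (Fin n) → ℝ≥0∞ :=
    fun p => ENNReal.ofReal (w p.1 ^ 2) * h (p.1 - p.2) with hT
  have hTm : AEMeasurable T (volume.prod volume) := by
    refine AEMeasurable.mul (by fun_prop) (hmeas.comp (by fun_prop)).aemeasurable
  have hTint : ∫⁻ p, T p ∂(volume.prod volume) < ⊤ := by
    rw [hT, lintegral_prod_mul_sub (f := fun x => ENNReal.ofReal (w x ^ 2)) (by fun_prop) hmeas]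
    refine ENNReal.mul_lt_top ?_ ((hM R hR).trans_lt ENNReal.ofReal_lt_top)
    have := hw.1
    rw [Measure.restrict_univ] at this
    exact this.integrable_sq.lintegral_lt_top
  rw [hsSeminorm, seminormSq_eq_setLIntegral_prod s univ (hwm.indicator hΩ), univ_prod_univ,
    setLIntegral_univ]
  refine ENNReal.rpow_lt_top_of_nonneg (by norm_num) (ne_of_lt (lt_of_le_of_lt
    (b := ∫⁻ p, (ENNReal.ofReal ((w p.1 - w p.2) ^ 2 / ‖p.1 - p.2‖ ^ ((n : ℝ) + 2 * s)) +
      T p) + T p.swap ∂(volume.prod volume)) ?_ ?_))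
  · refine lintegral_mono_ae ?_
    filter_upwards [Measure.quasiMeasurePreserving_fst.ae h0,
      Measure.quasiMeasurePreserving_snd.ae h0] with p h1 h2
    have key : ∀ x y, x ∈ Ω → y ∉ Ω → (y ∈ D \ Ω → w y = 0) →
        ENNReal.ofReal (w x ^ 2 / ‖x - y‖ ^ ((n : ℝ) + 2 * s)) ≤
          ENNReal.ofReal ((w x - w y) ^ 2 / ‖x - y‖ ^ ((n : ℝ) + 2 * s)) + T (x, y) := by
      intro x y hx hy hxy
      by_cases hyD : y ∈ D
      · rw [hxy ⟨hyD, hy⟩, sub_zero]; exact le_self_add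
      · refine le_trans (le_of_eq ?_) le_add_self
        have hmem : x - y ∈ {z : EuclideanSpace ℝ (Fin n) | R ≤ ‖z‖} := by
          simpa [dist_eq_norm] using hdist x hx y hyD
        simp only [hT, hh]
        rw [indicator_of_mem hmem, ← ENNReal.ofReal_mul (sq_nonneg _), div_eq_mul_inv]
    by_cases hx : p.1 ∈ Ω <;> by_cases hy : p.2 ∈ Ω
    · rw [indicator_of_mem hx, indicator_of_mem hy, add_assoc]; exact le_self_add
    · rw [indicator_of_mem hx, indicator_of_notMem hy, sub_zero]
      exact (key _ _ hx hy h2).trans le_self_add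
    · rw [indicator_of_notMem hx, indicator_of_mem hy, zero_sub, neg_sq, norm_sub_rev,
        add_right_comm, ← neg_sub (w p.2), neg_sq]
      exact (key _ _ hy hx h1).trans le_self_add
    · simp [hx, hy]
  · rw [lintegral_add_right' _ hTm.prod_swap, lintegral_add_right' _ hTm, lintegral_prod_swap T]
    exact ENNReal.add_lt_top.2 ⟨ENNReal.add_lt_top.2
      ⟨hw.integrable_sq_sub_div.lintegral_lt_top, hTint⟩, hTint⟩

/-- Testing with `indicator Ω w` turns the weak equation into an energy identity. -/
theorem energy_le {n : ℕ} {s : ℝ} {Ω D : Set (EuclideanSpace ℝ (Fin n))} (hΩ : MeasurableSet Ω)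
    (hsub : Ω ⊆ D)
    {w : EuclideanSpace ℝ (Fin n) → ℝ} (hw : MemHs s univ w)
    (hv : MemHs s univ (indicator Ω w)) (h0 : ∀ᵐ x, x ∈ D \ Ω → w x = 0)
    (hc : fracConst n s ≠ 0) (hform : form s Ω w (indicator Ω w) = 0) :
    seminormSq s Ω w + 2 * ∫⁻ p in Ω ×ˢ Ωᶜ,
        ENNReal.ofReal (w p.1 ^ 2 / ‖p.1 - p.2‖ ^ ((n : ℝ) + 2 * s)) ∂(volume.prod volume)
      ≤ 2 * ∫⁻ p in Ω ×ˢ Dᶜ,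
        ENNReal.ofReal (|w p.1| * |w p.2| / ‖p.1 - p.2‖ ^ ((n : ℝ) + 2 * s))
          ∂(volume.prod volume) := by
  set μ : Measure (EuclideanSpace ℝ (Fin n) × EuclideanSpace ℝ (Fin n)) := volume.prod volume
    with hμ
  set k : EuclideanSpace ℝ (Fin n) × EuclideanSpace ℝ (Fin n) → ℝ :=
    fun p => ‖p.1 - p.2‖ ^ ((n : ℝ) + 2 * s) with hk
  have hk0 : ∀ p, 0 ≤ k p := fun p => by positivity
  set v := indicator Ω w with hvdef
  set G : EuclideanSpace ℝ (Fin n) × EuclideanSpace ℝ (Fin n) → ℝ :=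
    fun p => (w p.1 - w p.2) * (v p.1 - v p.2) / k p with hG
  have hGi : Integrable G μ := hw.integrable_mul_div hv
  have hGswap : ∀ p, G p.swap = G p := fun p => by
    simp only [hG, hk, Prod.fst_swap, Prod.snd_swap]
    rw [norm_sub_rev]
    ring
  have hQ : ∫ p in (Ω ×ˢ univ) ∪ (univ ×ˢ Ω), G p ∂μ = 0 := by
    have := hform
    rw [form] at this
    exact (mul_eq_zero.1 this).resolve_left (div_ne_zero hc two_ne_zero)
  -- The two mixed pieces contribute equally by symmetry, which is the source of the factors 2.
  have hset : (Ω ×ˢ univ) ∪ (univ ×ˢ Ω) = ((Ω ×ˢ Ω) ∪ (Ω ×ˢ Ωᶜ)) ∪ (Ωᶜ ×ˢ Ω) := by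
    ext p
    simp only [mem_union, mem_prod, mem_univ, mem_compl_iff]
    tauto
  have hd1 : Disjoint ((Ω ×ˢ Ω) ∪ (Ω ×ˢ Ωᶜ)) (Ωᶜ ×ˢ Ω) := by
    rw [Set.disjoint_left]; simp only [mem_union, mem_prod, mem_compl_iff]; tauto
  have hd2 : Disjoint (Ω ×ˢ Ω) (Ω ×ˢ Ωᶜ) := by
    rw [Set.disjoint_left]; simp only [mem_prod, mem_compl_iff]; tauto
  have hsw : ∫ p in Ωᶜ ×ˢ Ω, G p ∂μ = ∫ p in Ω ×ˢ Ωᶜ, G p ∂μ := by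
    rw [hμ, ← setIntegral_prod_swap]
    simp only [hGswap]
  rw [hset, setIntegral_union hd1 (hΩ.compl.prod hΩ) hGi.integrableOn hGi.integrableOn,
    setIntegral_union hd2 (hΩ.prod hΩ.compl) hGi.integrableOn hGi.integrableOn, hsw] at hQ
  have hA : ∫ p in Ω ×ˢ Ω, G p ∂μ = ∫ p in Ω ×ˢ Ω, (w p.1 - w p.2) ^ 2 / k p ∂μ := by
    refine setIntegral_congr_fun (hΩ.prod hΩ) fun p hp => ?_
    simp only [hG, hvdef]
    rw [indicator_of_mem hp.1, indicator_of_mem hp.2, sq]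
  have hPi : IntegrableOn (fun p => w p.1 ^ 2 / k p) (Ω ×ˢ Ωᶜ) μ := by
    refine hv.integrable_sq_sub_div.integrableOn.congr_fun (fun p hp => ?_) (hΩ.prod hΩ.compl)
    simp only [hvdef]
    rw [indicator_of_mem hp.1, indicator_of_notMem hp.2, sub_zero]
  have hGB : EqOn G (fun p => w p.1 ^ 2 / k p - w p.1 * w p.2 / k p) (Ω ×ˢ Ωᶜ) := fun p hp => by
    simp only [hG, hvdef]
    rw [indicator_of_mem hp.1, indicator_of_notMem hp.2]
    ring
  -- The cross term is integrable as the difference of w(x)²/k, controlled by the energy of 1_Ω w,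
  -- and the form's integrand.
  have hNi : IntegrableOn (fun p => w p.1 * w p.2 / k p) (Ω ×ˢ Ωᶜ) μ := by
    refine (hPi.sub (hGi.integrableOn (s := Ω ×ˢ Ωᶜ))).congr_fun (fun p hp => ?_)
      (hΩ.prod hΩ.compl)
    rw [Pi.sub_apply, hGB hp]
    ring
  have hB : ∫ p in Ω ×ˢ Ωᶜ, G p ∂μ =
      ∫ p in Ω ×ˢ Ωᶜ, w p.1 ^ 2 / k p ∂μ - ∫ p in Ω ×ˢ Ωᶜ, w p.1 * w p.2 / k p ∂μ := by
    rw [setIntegral_congr_fun (hΩ.prod hΩ.compl) hGB, integral_sub hPi hNi]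
  have hsub' : Ω ×ˢ Dᶜ ⊆ Ω ×ˢ Ωᶜ := prod_mono_right (compl_subset_compl.2 hsub)
  have hN : ∫ p in Ω ×ˢ Ωᶜ, w p.1 * w p.2 / k p ∂μ = ∫ p in Ω ×ˢ Dᶜ, w p.1 * w p.2 / k p ∂μ := by
    refine setIntegral_eq_of_subset_of_ae_sdiff_eq_zero (hΩ.prod hΩ.compl).nullMeasurableSet
      hsub' ?_
    filter_upwards [Measure.quasiMeasurePreserving_snd.ae h0] with p h hp
    have hpD : p.2 ∈ D := by
      by_contra hpD
      exact hp.2 ⟨hp.1.1, hpD⟩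
    rw [h ⟨hpD, hp.1.2⟩]; simp
  have hN' : ∫ p in Ω ×ˢ Dᶜ, w p.1 * w p.2 / k p ∂μ ≤
      ∫ p in Ω ×ˢ Dᶜ, |w p.1| * |w p.2| / k p ∂μ := by
    have habs : ∀ p, |w p.1 * w p.2 / k p| = |w p.1| * |w p.2| / k p := fun p => by
      rw [abs_div, abs_mul, abs_of_nonneg (hk0 p)]
    have hi := (hNi.mono_set hsub')
    refine integral_mono hi (hi.abs.congr (ae_of_all _ habs)) fun p => ?_
    rw [← habs]
    exact le_abs_self _
  have hi' : IntegrableOn (fun p => |w p.1| * |w p.2| / k p) (Ω ×ˢ Dᶜ) μ :=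
    (hNi.mono_set hsub').abs.congr (ae_of_all _ fun p => by
      simp only; rw [abs_div, abs_mul, abs_of_nonneg (hk0 p)])
  have hAi : IntegrableOn (fun p => (w p.1 - w p.2) ^ 2 / k p) (Ω ×ˢ Ω) μ :=
    hw.integrable_sq_sub_div.integrableOn
  have htwo : ∀ x : ℝ, 2 * ENNReal.ofReal x = ENNReal.ofReal (2 * x) := fun x => by
    rw [ENNReal.ofReal_mul (by norm_num), ENNReal.ofReal_ofNat]
  rw [seminormSq_eq_setLIntegral_prod s Ω hw.aemeasurable,
    ← ofReal_integral_eq_lintegral_ofReal hAi (ae_of_all _ fun p => by positivity),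
    ← ofReal_integral_eq_lintegral_ofReal hPi
      (ae_of_all _ fun p => div_nonneg (sq_nonneg _) (hk0 p)),
    ← ofReal_integral_eq_lintegral_ofReal hi'
      (ae_of_all _ fun p => div_nonneg (by positivity) (hk0 p)),
    htwo, htwo, ← ENNReal.ofReal_add (integral_nonneg fun p => by positivity)
      (mul_nonneg (by norm_num) (integral_nonneg fun p => by positivity))]
  refine ENNReal.ofReal_le_ofReal ?_
  rw [hA, hB] at hQ
  linarith

/-- Young's inequality 2abκ ≤ θa²κ² + θ⁻¹b² puts the whole kernel on the factor in Ω: its square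
integrates to a tail in x - y, while the other term is a plain product carrying |Ω|. -/
theorem two_mul_setLIntegral_cross_le {n : ℕ} {s : ℝ} {Ω D : Set (EuclideanSpace ℝ (Fin n))}
    (hΩ : MeasurableSet Ω) (hD : MeasurableSet D) {R : ℝ}
    (hdist : ∀ x ∈ Ω, ∀ y ∉ D, R ≤ dist x y)
    {w : EuclideanSpace ℝ (Fin n) → ℝ} (hw : AEMeasurable w volume) {θ : ℝ} (hθ : 0 < θ) :
    2 * ∫⁻ p in Ω ×ˢ Dᶜ,
        ENNReal.ofReal (|w p.1| * |w p.2| / ‖p.1 - p.2‖ ^ ((n : ℝ) + 2 * s))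
          ∂(volume.prod volume)
      ≤ ENNReal.ofReal θ * (∫⁻ x in Ω, ENNReal.ofReal (w x ^ 2)) *
          (∫⁻ z, indicator {z : EuclideanSpace ℝ (Fin n) | R ≤ ‖z‖}
            (fun z => ENNReal.ofReal ((‖z‖ ^ (2 * ((n : ℝ) + 2 * s)))⁻¹)) z) +
        ENNReal.ofReal θ⁻¹ * volume Ω * ∫⁻ y in Dᶜ, ENNReal.ofReal (w y ^ 2) := by
  set α : ℝ := (n : ℝ) + 2 * s
  set h : EuclideanSpace ℝ (Fin n) → ℝ≥0∞ := indicator {z | R ≤ ‖z‖}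
    (fun z => ENNReal.ofReal ((‖z‖ ^ (2 * α))⁻¹)) with hh
  have hmeas : Measurable h :=
    Measurable.indicator (by fun_prop) (measurableSet_le measurable_const measurable_norm)
  have hf : AEMeasurable (fun x => ENNReal.ofReal (w x ^ 2)) volume := by fun_prop
  rw [← lintegral_const_mul' _ _ ENNReal.ofNat_ne_top]
  calc _ ≤ ∫⁻ p in Ω ×ˢ Dᶜ, (ENNReal.ofReal θ * (ENNReal.ofReal (w p.1 ^ 2) * h (p.1 - p.2)) +
            ENNReal.ofReal θ⁻¹ * (1 * ENNReal.ofReal (w p.2 ^ 2))) ∂(volume.prod volume) := by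
        refine setLIntegral_mono' (hΩ.prod hD.compl) fun p hp => ?_
        have hmem : p.1 - p.2 ∈ {z : EuclideanSpace ℝ (Fin n) | R ≤ ‖z‖} := by
          simpa [dist_eq_norm] using hdist p.1 hp.1 p.2 hp.2
        have htwo : ∀ x : ℝ, 2 * ENNReal.ofReal x = ENNReal.ofReal (2 * x) := fun x => by
          rw [ENNReal.ofReal_mul (by norm_num), ENNReal.ofReal_ofNat]
        simp only [hh]
        rw [indicator_of_mem hmem, one_mul, ← ENNReal.ofReal_mul (sq_nonneg _),
          ← ENNReal.ofReal_mul hθ.le, ← ENNReal.ofReal_mul (inv_nonneg.2 hθ.le),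
          ← ENNReal.ofReal_add (by positivity) (by positivity), htwo]
        refine ENNReal.ofReal_le_ofReal ?_
        have hk : ‖p.1 - p.2‖ ^ (2 * α) = (‖p.1 - p.2‖ ^ α) ^ 2 := by
          rw [mul_comm, ← Real.rpow_natCast, ← Real.rpow_mul (norm_nonneg _)]; simp
        rw [hk, div_eq_mul_inv, ← sq_abs (w p.1), ← sq_abs (w p.2), ← inv_pow]
        set a := |w p.1|
        set b := |w p.2|
        set κ := (‖p.1 - p.2‖ ^ α)⁻¹
        have : θ * (a ^ 2 * κ ^ 2) + θ⁻¹ * b ^ 2 - 2 * (a * b * κ) = θ⁻¹ * (θ * a * κ - b) ^ 2 := by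
          field_simp
          ring
        have h2 : 0 ≤ θ⁻¹ * (θ * a * κ - b) ^ 2 := by positivity
        linarith
    _ = ENNReal.ofReal θ * (∫⁻ p in Ω ×ˢ Dᶜ, ENNReal.ofReal (w p.1 ^ 2) * h (p.1 - p.2)
            ∂(volume.prod volume)) +
          ENNReal.ofReal θ⁻¹ * (volume Ω * ∫⁻ y in Dᶜ, ENNReal.ofReal (w y ^ 2)) := by
        rw [lintegral_add_right' _ (AEMeasurable.restrict (by fun_prop)),
          lintegral_const_mul' _ _ ENNReal.ofReal_ne_top,
          lintegral_const_mul' _ _ ENNReal.ofReal_ne_top, ← Measure.prod_restrict,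
          lintegral_prod_mul (f := fun _ : EuclideanSpace ℝ (Fin n) => (1 : ℝ≥0∞))
            (g := fun y => ENNReal.ofReal (w y ^ 2)) aemeasurable_const hf.restrict]
        simp
    -- Since `h` already encodes |x - y| ≥ R, y may range over the whole space, where translation
    -- invariance applies.
    _ ≤ ENNReal.ofReal θ * (∫⁻ p in Ω ×ˢ univ, ENNReal.ofReal (w p.1 ^ 2) * h (p.1 - p.2)
            ∂(volume.prod volume)) +
          ENNReal.ofReal θ⁻¹ * (volume Ω * ∫⁻ y in Dᶜ, ENNReal.ofReal (w y ^ 2)) := by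
        gcongr
        exact subset_univ _
    _ = _ := by
        rw [← Measure.prod_restrict, Measure.restrict_univ,
          lintegral_prod_mul_sub (f := fun x => ENNReal.ofReal (w x ^ 2)) hf.restrict hmeas,
          mul_assoc, mul_assoc]

theorem le_setLIntegral_compl_of_kernel_ge {n : ℕ} {α ρ : ℝ}
    {Ω : Set (EuclideanSpace ℝ (Fin n))} (hΩ : MeasurableSet Ω)
    (hρ : ∀ x ∈ Ω, ENNReal.ofReal ρ ≤ ∫⁻ y in Ωᶜ, ENNReal.ofReal ((‖x - y‖ ^ α)⁻¹))
    {w : EuclideanSpace ℝ (Fin n) → ℝ} (hw : AEMeasurable w volume) :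
    ENNReal.ofReal ρ * ∫⁻ x in Ω, ENNReal.ofReal (w x ^ 2) ≤
      ∫⁻ p in Ω ×ˢ Ωᶜ, ENNReal.ofReal (w p.1 ^ 2 / ‖p.1 - p.2‖ ^ α) ∂(volume.prod volume) := by
  rw [setLIntegral_prod _ (AEMeasurable.restrict (by fun_prop)),
    ← lintegral_const_mul' _ _ ENNReal.ofReal_ne_top]
  refine setLIntegral_mono' hΩ fun x hx => ?_
  simp only [div_eq_mul_inv, ENNReal.ofReal_mul (sq_nonneg (w x))]
  rw [lintegral_const_mul' _ _ ENNReal.ofReal_ne_top, mul_comm]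
  gcongr
  exact hρ x hx

/-- The far-field estimate: the energy in `Ω` of a function that is `s`-harmonic in `Ω` and
vanishes at distance less than `R` from `Ω`. -/
theorem exists_seminormSq_le {n : ℕ} (hn : 1 ≤ n) {s : ℝ} (hs : 0 < s) (hs₁ : s < 1)
    {Ω : Set (EuclideanSpace ℝ (Fin n))} (hΩ : IsOpen Ω) (hb : Bornology.IsBounded Ω) :
    ∃ L : ℝ, 0 < L ∧ ∀ (D : Set (EuclideanSpace ℝ (Fin n))), MeasurableSet D → Ω ⊆ D →
      ∀ R : ℝ, 0 < R → (∀ x ∈ Ω, ∀ y ∉ D, R ≤ dist x y) →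
      ∀ w : EuclideanSpace ℝ (Fin n) → ℝ, MemHs s univ w → (∀ᵐ x, x ∈ D \ Ω → w x = 0) →
      (∀ v, MemHsTilde s Ω v → form s Ω w v = 0) →
      seminormSq s Ω w ≤ ENNReal.ofReal (L * R ^ (-((n : ℝ) + 4 * s))) *
        eLpNorm w 2 (volume.restrict Dᶜ) ^ 2 := by
  have hα : 0 < (n : ℝ) + 2 * s := by positivity
  obtain ⟨M, hM0, hM⟩ := lintegral_norm_rpow_tail (n := n) (β := 2 * ((n : ℝ) + 2 * s))
    (by linarith)
  obtain ⟨ρ, hρ0, hρ⟩ := exists_lintegral_compl_kernel_ge hn hb hα.le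
  have hVt : volume Ω ≠ ⊤ := hb.measure_lt_top.ne
  have hc : fracConst n s ≠ 0 := by
    have h1 : 0 < Real.Gamma (s + n / 2) := Real.Gamma_pos_of_pos (by positivity)
    have h2 : 0 < Real.Gamma (1 - s) := Real.Gamma_pos_of_pos (by linarith)
    rw [fracConst]
    positivity
  refine ⟨M / (2 * ρ) * ((volume Ω).toReal + 1), by positivity,
    fun D hD hsub R hR hdist w hw h0 hform => ?_⟩
  have hv := hw.indicator_memHsTilde hs hΩ.measurableSet hR hdist h0
  have hE := energy_le hΩ.measurableSet hsub hw hv.1 h0 hc (hform _ hv)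
  have hwm := hw.aemeasurable
  set a := ∫⁻ x in Ω, ENNReal.ofReal (w x ^ 2) with ha
  have hat : a ≠ ⊤ := by
    have := hw.1
    rw [Measure.restrict_univ] at this
    exact (this.integrable_sq.integrableOn (s := Ω)).lintegral_lt_top.ne
  have hT : 0 < M * R ^ (-((n : ℝ) + 4 * s)) := by positivity
  set T := M * R ^ (-((n : ℝ) + 4 * s)) with hTdef
  -- With this Young parameter, θT = 2ρ matches the coefficient of ‖w‖²_{L²(Ω)} on the left.
  have hθ : 0 < 2 * ρ / T := by positivity
  have hMR := hM R hR
  rw [show (n : ℝ) - 2 * ((n : ℝ) + 2 * s) = -((n : ℝ) + 4 * s) by ring, ← hTdef] at hMR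
  have hlow := le_setLIntegral_compl_of_kernel_ge hΩ.measurableSet hρ hwm
  have hup := two_mul_setLIntegral_cross_le (s := s) hΩ.measurableSet hD hdist hwm hθ
  have hb : ∫⁻ y in Dᶜ, ENNReal.ofReal (w y ^ 2) = eLpNorm w 2 (volume.restrict Dᶜ) ^ 2 := by
    have := eLpNorm_nnreal_pow_eq_lintegral (f := w) (μ := volume.restrict Dᶜ) (p := 2) two_ne_zero
    simp only [NNReal.coe_ofNat, ENNReal.coe_ofNat, ENNReal.rpow_ofNat] at this
    rw [this]
    refine lintegral_congr fun y => ?_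
    rw [← sq_abs, ENNReal.ofReal_pow (abs_nonneg _), Real.enorm_eq_ofReal_abs]
  rw [hb] at hup
  have hle : seminormSq s Ω w + ENNReal.ofReal (2 * ρ) * a ≤
      ENNReal.ofReal (2 * ρ / T)⁻¹ * volume Ω * eLpNorm w 2 (volume.restrict Dᶜ) ^ 2 +
        ENNReal.ofReal (2 * ρ) * a := by
    calc _ ≤ _ := by
          refine le_trans ?_ hE
          rw [ENNReal.ofReal_mul (by norm_num), ENNReal.ofReal_ofNat, mul_assoc]
          gcongr
      _ ≤ _ := hup
      _ ≤ ENNReal.ofReal (2 * ρ / T) * a * ENNReal.ofReal T +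
          ENNReal.ofReal (2 * ρ / T)⁻¹ * volume Ω * eLpNorm w 2 (volume.restrict Dᶜ) ^ 2 := by
        gcongr
      _ = _ := by
        rw [add_comm, mul_right_comm (ENNReal.ofReal (2 * ρ / T)), ← ENNReal.ofReal_mul hθ.le, div_mul_cancel₀ _ hT.ne']
  -- Cancelling the common term in [0, ∞] requires ‖w‖_{L²(Ω)} to be finite.
  refine ((ENNReal.add_le_add_iff_right
    (ENNReal.mul_ne_top ENNReal.ofReal_ne_top hat)).1 hle).trans ?_
  gcongr
  rw [← ENNReal.ofReal_toReal hVt, ← ENNReal.ofReal_mul (by positivity)]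
  refine ENNReal.ofReal_le_ofReal ?_
  rw [ENNReal.toReal_ofReal ENNReal.toReal_nonneg, inv_div,
    show M / (2 * ρ) * ((volume Ω).toReal + 1) * R ^ (-((n : ℝ) + 4 * s)) =
      T / (2 * ρ) * ((volume Ω).toReal + 1) by rw [hTdef]; ring]
  gcongr
  linarith

end FracDirichlet

/-! ### Application to the truncated datum. -/

theorem mainTheorem8 (n : ℕ) (hn : 1 ≤ n) (s : ℝ) (hs₀ : 0 < s) (hs₁ : s < 1)
    (Ω : Set (EuclideanSpace ℝ (Fin n))) (hΩ : FracDirichlet.IsBoundedSmoothDomain Ω)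
    (c C : ℝ) (hc : 0 < c) (hC : 0 < C) :
    ∃ K : ℝ, 0 < K ∧
      ∀ (H₀ : ℝ) (_ : 1 ≤ H₀) (D : ℝ → Set (EuclideanSpace ℝ (Fin n)))
        (_ : FracDirichlet.IsTruncationFamily Ω c C H₀ D)
        (H : ℝ) (_ : H₀ < H - 1)
        (η : EuclideanSpace ℝ (Fin n) → ℝ)
        (_ : FracDirichlet.IsCutoff Ω (D H) (D (H - 1)) η)
        (F : (EuclideanSpace ℝ (Fin n) → ℝ) → ℝ) (_ : FracDirichlet.IsHsDual s Ω F)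
        (g : EuclideanSpace ℝ (Fin n) → ℝ) (_ : FracDirichlet.MemHs s Ωᶜ g)
        (u : EuclideanSpace ℝ (Fin n) → ℝ) (_ : FracDirichlet.IsSolution s Ω F g u)
        (u' : EuclideanSpace ℝ (Fin n) → ℝ)
        (_ : FracDirichlet.IsSolution s Ω F (fun x => η x * g x) u'),
        FracDirichlet.hsSeminorm s Ω (u - u') ≤
          ENNReal.ofReal (K * H ^ (-((n : ℝ) / 2 + 2 * s))) *
            eLpNorm g 2 (volume.restrict (D (H - 1))ᶜ) := by
  obtain ⟨L, hL, hLe⟩ := FracDirichlet.exists_seminormSq_le hn hs₀ hs₁ hΩ.isOpen hΩ.isBounded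
  refine ⟨Real.sqrt L * (c / 2) ^ (-((n : ℝ) / 2 + 2 * s)), by positivity, ?_⟩
  intro H₀ hH₀ D hD H hH η hη F _ g _ u hu u' hu'
  have hDo := hD.isOpen _ hH
  have hsub := hD.subset _ hH
  have hHpos : 0 < H := by linarith
  have hR : 0 < c / 2 * H := by positivity
  -- H - 1 > H₀ ≥ 1 forces H > 2, so c(H - 1) ≥ cH/2.
  have hdist : ∀ x ∈ Ω, ∀ y ∉ D (H - 1), c / 2 * H ≤ dist x y := fun x hx y hy =>
    le_trans (by nlinarith) (FracDirichlet.le_dist_of_le_dist_frontier hΩ.isOpen hDo hsub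
      (fun a ha b hb => (hD.dist_bounds _ hH a ha b hb).1) hx hy)
  have hae : ∀ᵐ x, x ∈ Ωᶜ → (u - u') x = (1 - η x) * g x := by
    filter_upwards [(ae_restrict_iff' hΩ.isOpen.measurableSet.compl).1 hu.eq_datum,
      (ae_restrict_iff' hΩ.isOpen.measurableSet.compl).1 hu'.eq_datum] with x h1 h2 hx
    rw [Pi.sub_apply, h1 hx, h2 hx]
    ring
  have hmain := hLe (D (H - 1)) hDo.measurableSet hsub (c / 2 * H) hR hdist (u - u')
    (hu.memHs.sub hu'.memHs)
    (by
      filter_upwards [hae] with x hx hxD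
      rw [hx hxD.2, hη.eq_one x hxD, sub_self, zero_mul])
    (fun v hv => by
      rw [FracDirichlet.form_sub hu.memHs hu'.memHs hv.1, hu.weak_eq v hv, hu'.weak_eq v hv,
        sub_self])
  have hnorm : eLpNorm (u - u') 2 (volume.restrict (D (H - 1))ᶜ) ≤
      eLpNorm g 2 (volume.restrict (D (H - 1))ᶜ) := by
    refine eLpNorm_mono_ae ((ae_restrict_iff' hDo.measurableSet.compl).2 ?_)
    filter_upwards [hae] with x hx hxD
    have hxΩ : x ∈ Ωᶜ := fun h => hxD (hsub h)
    rw [hx hxΩ, norm_mul]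
    refine mul_le_of_le_one_left (norm_nonneg _) ?_
    rw [Real.norm_eq_abs, abs_le]
    constructor <;> linarith [hη.nonneg x hxΩ, hη.le_one x hxΩ]
  set e : ℝ := (n : ℝ) / 2 + 2 * s with he
  -- Since 2e = n + 4s, the squared estimate's constant is a perfect square, whence √L (c/2)^{-e} in
  -- the witness.
  have hconst : L * (c / 2 * H) ^ (-((n : ℝ) + 4 * s)) =
      (Real.sqrt L * (c / 2) ^ (-e) * H ^ (-e)) ^ 2 := by
    rw [mul_assoc, ← Real.mul_rpow (by positivity) hHpos.le, mul_pow, Real.sq_sqrt hL.le,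
      ← Real.rpow_natCast (_ ^ _) 2, ← Real.rpow_mul hR.le]
    congr 2
    rw [he]; push_cast; ring
  rw [FracDirichlet.hsSeminorm, one_div, ENNReal.rpow_inv_le_iff (by norm_num), ENNReal.rpow_two,
    mul_pow, ← ENNReal.ofReal_pow (by positivity), ← hconst]
  exact hmain.trans (by gcongr)
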